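/- Let $k$ be an algebraically closed field, let $S=k[[\alpha_1,\dots,\alpha_n]]$ with maximal ideal $\mathfrak m$, and let $P\subset \operatorname{Hom}_k(S,k)$ be the space of functionals vanishing on some power of $\mathfrak m$. It has as a basis the divided power monomials $x^{[a]}$ ($a\in\mathbb N_0^n$), dual to the monomials $\alpha^a$; the degree of $x^{[a]}$ is $\sum a_i$, and $\deg 0<0$. Write $\langle\sigma,f\rangle=f(\sigma)$, and let $S$ act on $P$ by contraction, $\langle\tau,\sigma\lrcorner f\rangle=\langle\tau\sigma,f\rangle$. Put $\operatorname{Ann}(f)=\{\sigma\in S:\sigma\lrcorner f=0\}$ and $\operatorname{Apolar}(f)=S/\operatorname{Ann}(f)$. Let $\mathbb G^+=\operatorname{Aut}^+(S)\ltimes(1+\mathfrak m)$ be the group of $k$-linear automorphisms of $S$ generated by the $k$-algebra automorphisms $\varphi$ with $\varphi(\alpha_i)-\alpha_i\in\mathfrak m^2$ for all $i$ and by the multiplications by elements of $1+\mathfrak m$. Let $\mathfrak g^+=\mathfrak{aut}^++\mathfrak m\subset\operatorname{End}_k(S)$, where $\mathfrak{aut}^+$ is the space of $k$-derivations $D$ of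 $S$ with $D(\mathfrak m)\subseteq\mathfrak m^2$ and $\mathfrak m$ acts by multiplication. Both act on $P$ through the dual maps, $\langle\sigma,L^\vee f\rangle=\langle L\sigma,f\rangle$; denote by $\mathbb G^+\!\cdot f$ the orbit of $f$ and put $\mathfrak g^+f=\{L^\vee f: L\in\mathfrak g^+\}$. For a subspace $W\subseteq P$ let $W^\perp=\{\sigma\in S:\langle\sigma,w\rangle=0\ \text{for all } w\in W\}$. For a subspace $V\subseteq S$ let $V_i$ be the set of its homogeneous elements of degree $i$. Let $f\in P$ be non-zero of degree $d$, with leading form (homogeneous part of degree $d$) $F$. Assume that the characteristic of $k$ is $0$ or greater than $d$. Let $I=\operatorname{Ann}(F)$, and let $t\ge 0$ be an integer such that 1. $\dim_k\operatorname{Apolar}(f)=\dim_k\operatorname{Apolar}(F)$, and 2. $\big((\mathfrak g^+F)^\perp\big)_i=(I^2)_i$ for all $i$ with $t\le i\le d-1$. Then there is $g\in P$ with $\deg g<t$ such that $F+g\in\mathbb G^+\!\cdot f$; moreover $\operatorname{Apolar}(f)\cong\operatorname{Apolar}(F+g)$ as $k$-algebras for this $g$. -/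

import Mathlib

namespace Macaulay

noncomputable section

variable (k : Type*) [Field k] (n : ℕ)

/-- The power series ring `S = k[[α₁, …, αₙ]]`. -/
abbrev S : Type _ := MvPowerSeries (Fin n) k

/-- The maximal ideal `𝔪` of `S`. -/
abbrev maxIdeal : Ideal (S k n) := IsLocalRing.maximalIdeal (S k n)

/-- The dual space `P ⊆ S^∨ = Hom_k(S, k)` (the divided power polynomials): the functionals
that vanish on some power of the maximal ideal. The pairing `⟨σ, f⟩` is the evaluation `f σ`. -/
def P : Submodule k (Module.Dual k (S k n)) where
  carrier := {f | ∃ D : ℕ, ∀ σ ∈ maxIdeal k n ^ D, f σ = 0}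
  zero_mem' := ⟨0, fun _ _ => rfl⟩
  add_mem' := by
    rintro f g ⟨D, hD⟩ ⟨E, hE⟩
    refine ⟨max D E, fun σ hσ => ?_⟩
    rw [LinearMap.add_apply, hD σ (Ideal.pow_le_pow_right (le_max_left _ _) hσ),
      hE σ (Ideal.pow_le_pow_right (le_max_right _ _) hσ), add_zero]
  smul_mem' := by
    rintro c f ⟨D, hD⟩
    exact ⟨D, fun σ hσ => by rw [LinearMap.smul_apply, hD σ hσ, smul_zero]⟩

variable {k n}

/-- Contraction `σ ⌟ f`, given by `⟨τ, σ ⌟ f⟩ = ⟨τ σ, f⟩`. -/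
def contract (σ : S k n) (f : P k n) : P k n :=
  ⟨f.1 ∘ₗ LinearMap.mulRight k σ, by
    obtain ⟨D, hD⟩ := f.2
    exact ⟨D, fun τ hτ => hD _ (Ideal.mul_mem_right _ _ hτ)⟩⟩

theorem contract_apply (σ τ : S k n) (f : P k n) : (contract σ f).1 τ = f.1 (τ * σ) := rfl

/-- The apolar ideal `Ann(f) = {σ ∈ S | σ ⌟ f = 0}`. -/
def apolarIdeal (f : P k n) : Ideal (S k n) where
  carrier := {σ | contract σ f = 0}
  zero_mem' := Subtype.ext <| LinearMap.ext fun τ => by simp [contract_apply]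
  add_mem' := by
    intro σ ρ hσ hρ
    refine Subtype.ext <| LinearMap.ext fun τ => ?_
    have h₁ : f.1 (τ * σ) = 0 := by rw [← contract_apply, hσ]; rfl
    have h₂ : f.1 (τ * ρ) = 0 := by rw [← contract_apply, hρ]; rfl
    simp [contract_apply, mul_add, h₁, h₂]
  smul_mem' := by
    intro c σ hσ
    refine Subtype.ext <| LinearMap.ext fun τ => ?_
    have h₁ : f.1 (τ * c * σ) = 0 := by rw [← contract_apply, hσ]; rfl
    simpa [contract_apply, mul_assoc] using h₁

/-- The apolar algebra `Apolar(f) = S / Ann(f)`. -/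
abbrev Apolar (f : P k n) : Type _ := S k n ⧸ apolarIdeal f

theorem le_order_of_mem_pow {D : ℕ} {σ : S k n} (hσ : σ ∈ maxIdeal k n ^ D) :
    (D : ℕ∞) ≤ σ.order := by
  induction D generalizing σ with
  | zero => simp
  | succ D ih =>
    rw [pow_succ] at hσ
    refine Submodule.mul_induction_on hσ (fun a ha b hb => ?_) (fun a b ha hb => ?_)
    · have hb' : (1 : ℕ∞) ≤ b.order := by
        rw [MvPowerSeries.one_le_order_iff_constCoeff_eq_zero]
        by_contra h
        rw [IsLocalRing.mem_maximalIdeal, mem_nonunits_iff, MvPowerSeries.isUnit_iff_constantCoeff,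
          isUnit_iff_ne_zero] at hb
        exact hb h
      push_cast
      exact (add_le_add (ih ha) hb').trans MvPowerSeries.le_order_mul
    · exact (le_min ha hb).trans MvPowerSeries.min_order_le_add

/-- The divided power monomial `x^[a]`, the functional dual to `α^a`:
it takes a power series to its coefficient at `α^a`. -/
def dpMonomial (a : Fin n →₀ ℕ) : P k n :=
  ⟨MvPowerSeries.coeff a, a.degree + 1, fun σ hσ =>
    MvPowerSeries.coeff_of_lt_order <| lt_of_lt_of_le
      (by exact_mod_cast Nat.lt_succ_self _) (le_order_of_mem_pow hσ)⟩

/-- The coefficient `⟨α^a, f⟩` of `x^[a]` in `f`. -/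
def dpCoeff (f : P k n) (a : Fin n →₀ ℕ) : k := f.1 (MvPowerSeries.monomial a 1)

theorem dpCoeff_dpMonomial (a b : Fin n →₀ ℕ) :
    dpCoeff (dpMonomial a : P k n) b = if a = b then 1 else 0 := by
  classical
  exact MvPowerSeries.coeff_monomial a b 1

theorem monomial_mem_pow (a : Fin n →₀ ℕ) :
    (MvPowerSeries.monomial a 1 : S k n) ∈ maxIdeal k n ^ a.degree := by
  have hX : ∀ i, (MvPowerSeries.X i : S k n) ∈ maxIdeal k n := fun i => by
    rw [IsLocalRing.mem_maximalIdeal, mem_nonunits_iff, MvPowerSeries.isUnit_iff_constantCoeff]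
    simp
  induction a using Finsupp.induction_linear with
  | zero => simp
  | add a b ha hb =>
    have h : (MvPowerSeries.monomial (a + b) 1 : S k n) =
        MvPowerSeries.monomial a 1 * MvPowerSeries.monomial b 1 := by
      rw [MvPowerSeries.monomial_mul_monomial, one_mul]
    rw [h, map_add, pow_add]
    exact Ideal.mul_mem_mul ha hb
  | single i m =>
    rw [Finsupp.degree_single, ← MvPowerSeries.X_pow_eq]
    exact Ideal.pow_mem_pow (hX i) m

theorem finite_dpSupport (f : P k n) : {a | dpCoeff f a ≠ 0}.Finite := by
  obtain ⟨D, hD⟩ := f.2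
  refine (Finsupp.finite_of_degree_le (σ := Fin n) D).subset fun a ha => ?_
  by_contra h
  exact ha (hD _ (Ideal.pow_le_pow_right (le_of_not_ge h) (monomial_mem_pow a)))

/-- The degree of `f ∈ P`, where `x^[a]` has degree `∑ aᵢ`; the degree of `0` is `⊥`. -/
def degree (f : P k n) : WithBot ℕ :=
  (finite_dpSupport f).toFinset.sup fun a => (a.degree : WithBot ℕ)

/-- The homogeneous part of degree `e` of `f ∈ P`. -/
def homogPart (e : ℕ) (f : P k n) : P k n :=
  ∑ a ∈ Finset.univ.finsuppAntidiag e, dpCoeff f a • dpMonomial a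

variable (k n)

/-- The group `𝔾⁺ = Aut⁺(S) ⋉ (1 + 𝔪)`, inside the group of `k`-linear automorphisms of `S`:
it is generated by the `k`-algebra automorphisms `φ` of `S` with `φ(αᵢ) - αᵢ ∈ 𝔪²` for all `i`
and by the multiplications by elements of `1 + 𝔪`. -/
def unipotentGroup : Subgroup (S k n ≃ₗ[k] S k n) :=
  Subgroup.closure
    ({L | ∃ φ : S k n ≃ₐ[k] S k n,
        (∀ i, φ (MvPowerSeries.X i) - MvPowerSeries.X i ∈ maxIdeal k n ^ 2) ∧
          L = φ.toLinearEquiv} ∪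
      {L | ∃ s : S k n, s - 1 ∈ maxIdeal k n ∧ ∀ τ, L τ = s * τ})

/-- `𝔞𝔲𝔱⁺`: the `k`-derivations `D` of `S` with `D(𝔪) ⊆ 𝔪²`, as linear endomorphisms of `S`. -/
def unipotentDerivations : Submodule k (Module.End k (S k n)) where
  carrier := {L | ∃ D : Derivation k (S k n) (S k n),
    (∀ σ ∈ maxIdeal k n, D σ ∈ maxIdeal k n ^ 2) ∧ L = D}
  zero_mem' := ⟨0, fun _ _ => by simp, rfl⟩
  add_mem' := by
    rintro _ _ ⟨D, hD, rfl⟩ ⟨E, hE, rfl⟩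
    exact ⟨D + E, fun σ hσ => Ideal.add_mem _ (hD σ hσ) (hE σ hσ), rfl⟩
  smul_mem' := by
    rintro c _ ⟨D, hD, rfl⟩
    exact ⟨c • D, fun σ hσ => Submodule.smul_of_tower_mem _ c (hD σ hσ), rfl⟩

/-- `𝔤⁺ = 𝔞𝔲𝔱⁺ + 𝔪`, where `𝔪` acts on `S` by multiplication. -/
def unipotentTangent : Submodule k (Module.End k (S k n)) :=
  unipotentDerivations k n ⊔
    ((maxIdeal k n).restrictScalars k).map (LinearMap.mul k (S k n))

variable {k n}

/-- The orbit `𝔾⁺ f`, where `L ∈ 𝔾⁺` acts through the dual map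
`L^∨`, `⟨σ, L^∨ f⟩ = ⟨L σ, f⟩`. -/
def unipotentOrbit (f : P k n) : Set (P k n) :=
  {h | ∃ L ∈ unipotentGroup k n, h.1 = (L : S k n →ₗ[k] S k n).dualMap f.1}

/-- The space `𝔤⁺ f = {L^∨ f | L ∈ 𝔤⁺}`. -/
def tangentSpace (f : P k n) : Submodule k (Module.Dual k (S k n)) :=
  (unipotentTangent k n).map (LinearMap.compRight k f.1)

/-- `W^⊥ = {σ ∈ S | ⟨σ, w⟩ = 0 for all w ∈ W}`. -/
abbrev perp (W : Submodule k (Module.Dual k (S k n))) : Submodule k (S k n) :=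
  W.dualCoannihilator

/-- The degree-`i` part of a subspace of `S`: its homogeneous elements of degree `i`. -/
def gradedPart (i : ℕ) (V : Submodule k (S k n)) : Set (S k n) :=
  {σ | σ ∈ V ∧ MvPowerSeries.IsHomogeneous σ i}

end

end Macaulay

/-!
Let `F` be the leading form of `f`. The terms of `f - F` are removed one degree at a time, from the
top. Suppose that `f - F` has degree at most `e < d`. Initial forms of elements of `Ann(f)` always
lie in `Ann(F)`, and equality of dimensions makes every homogeneous element of `Ann(F)` such an
initial form. Hence, for `x, y` homogeneous in `Ann(F)` with `xy` of degree `e` and `v ∈ Ann(f)` of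
initial form `x`, one gets `⟨xy, f⟩ = -⟨(v - x)y, f⟩ = -⟨(v - x)y, F⟩ = 0`: the degree-`e` part of
`f` kills `(Ann(F)²)ₑ = ((𝔤⁺F)^⊥)ₑ`, so by duality it agrees in degree `e` with `L^∨ F` for some
`L ∈ 𝔤⁺`. An element of `𝔾⁺` of the form `1 - L_{d-e} + ⋯`, where `L_{d-e}` is the part of `L`
raising degrees by `d - e`, cancels this part of `f` and changes nothing in higher degree.
-/

namespace Macaulay

open MvPowerSeries

variable {k : Type*} [Field k] {n : ℕ}

/-! ### Power series and powers of the maximal ideal -/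

section PowerSeries

variable {σ R : Type*}

section Semiring

variable [Semiring R]

theorem homogeneousComponent_of_isHomogeneous {f : MvPowerSeries σ R} {p : ℕ}
    (hf : IsHomogeneous f p) : homogeneousComponent p f = f :=
  (isHomogeneous_iff_eq_homogeneousComponent.1 hf).symm

theorem homogeneousComponent_eq_ite_of_isHomogeneous {f : MvPowerSeries σ R} {p q : ℕ}
    (hf : IsHomogeneous f q) : homogeneousComponent p f = if p = q then f else 0 := by
  split_ifs with hpq
  · rw [hpq, homogeneousComponent_of_isHomogeneous hf]
  · ext a
    rw [coeff_homogeneousComponent, map_zero]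
    split_ifs with ha
    · exact hf.coeff_eq_zero (ha.trans_ne hpq)
    · rfl

theorem homogeneousComponent_homogeneousComponent (p q : ℕ) (f : MvPowerSeries σ R) :
    homogeneousComponent p (homogeneousComponent q f) =
      if p = q then homogeneousComponent q f else 0 :=
  homogeneousComponent_eq_ite_of_isHomogeneous (isHomogeneous_homogeneousComponent f q)

theorem isHomogeneous_zero (p : ℕ) : IsHomogeneous (0 : MvPowerSeries σ R) p :=
  isHomogeneous_iff_eq_homogeneousComponent.2 (map_zero _).symm

theorem isHomogeneous_monomial (a : σ →₀ ℕ) (c : R) :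
    IsHomogeneous (monomial a c) a.degree := by
  classical
  rw [isHomogeneous_iff_eq_homogeneousComponent]
  ext b
  rw [coeff_homogeneousComponent, coeff_monomial]
  split_ifs <;> simp_all

theorem isHomogeneous_X (i : σ) : IsHomogeneous (X i : MvPowerSeries σ R) 1 :=
  Finsupp.degree_single i 1 ▸ isHomogeneous_monomial (Finsupp.single i 1) (1 : R)

theorem homogeneousComponent_mul (p : ℕ) (f g : MvPowerSeries σ R) :
    homogeneousComponent p (f * g) = ∑ x ∈ Finset.HasAntidiagonal.antidiagonal p,
      homogeneousComponent x.1 f * homogeneousComponent x.2 g := by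
  classical
  ext a
  simp only [map_sum, coeff_homogeneousComponent, coeff_mul, ite_zero_mul_ite_zero]
  have hinner : ∀ y ∈ Finset.HasAntidiagonal.antidiagonal a,
      ∑ x ∈ Finset.HasAntidiagonal.antidiagonal p,
        (if y.1.degree = x.1 ∧ y.2.degree = x.2 then coeff y.1 f * coeff y.2 g else 0) =
      if a.degree = p then coeff y.1 f * coeff y.2 g else 0 := fun y hy => by
    rw [← Finset.HasAntidiagonal.mem_antidiagonal.1 hy, map_add]
    simp only [← Prod.mk_inj, Prod.mk.eta, Finset.sum_ite_eq,
      Finset.HasAntidiagonal.mem_antidiagonal]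
  rw [Finset.sum_comm, Finset.sum_congr rfl hinner]
  split_ifs <;> simp

theorem homogeneousComponent_mul_of_isHomogeneous {f : MvPowerSeries σ R} {p : ℕ}
    (hf : IsHomogeneous f p) (q : ℕ) (g : MvPowerSeries σ R) :
    homogeneousComponent (p + q) (f * g) = f * homogeneousComponent q g := by
  rw [homogeneousComponent_mul, Finset.sum_eq_single_of_mem (p, q) (by simp),
    homogeneousComponent_of_isHomogeneous hf]
  rintro ⟨i, j⟩ hij hne
  rw [Finset.HasAntidiagonal.mem_antidiagonal] at hij
  have hip : i ≠ p := fun h => hne (Prod.ext h (by simp_all))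
  rw [homogeneousComponent_eq_ite_of_isHomogeneous hf, if_neg hip, zero_mul]

theorem homogeneousComponent_eq_sum [Fintype σ] [DecidableEq σ] (p : ℕ) (f : MvPowerSeries σ R) :
    homogeneousComponent p f =
      ∑ a ∈ Finset.univ.finsuppAntidiag p, coeff a f • monomial a (1 : R) := by
  ext b
  simp [map_sum, coeff_homogeneousComponent, coeff_monomial, Finset.mem_finsuppAntidiag,
    Finsupp.degree_eq_sum]

theorem nat_succ_le_order_iff {f : MvPowerSeries σ R} {p : ℕ} :
    ((p + 1 : ℕ) : ℕ∞) ≤ f.order ↔ p ≤ f.order ∧ homogeneousComponent p f = 0 := by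
  refine ⟨fun h => ?_, fun ⟨h, hp⟩ => nat_le_order fun a ha => ?_⟩
  · have hp : (p : ℕ∞) < f.order := lt_of_lt_of_le (by exact_mod_cast Nat.lt_succ_self p) h
    exact ⟨hp.le, homogeneousComponent_of_lt_order_eq_zero hp⟩
  · rcases (Nat.lt_succ_iff.1 ha).lt_or_eq with hlt | rfl
    · exact coeff_of_lt_order (lt_of_lt_of_le (by exact_mod_cast hlt) h)
    · simpa [coeff_homogeneousComponent] using congrArg (coeff a) hp

end Semiring

section CommRing

variable [CommRing R]

theorem coe_mem_span_X_pow {f : MvPolynomial σ R} {p : ℕ}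
    (hf : f ∈ MvPolynomial.idealOfVars σ R ^ p) :
    (f : MvPowerSeries σ R) ∈ Ideal.span (Set.range X) ^ p := by
  have h := Ideal.mem_map_of_mem (MvPolynomial.coeToMvPowerSeries.ringHom (σ := σ) (R := R)) hf
  rwa [Ideal.map_pow, Ideal.map_span, ← Set.range_comp,
    show MvPolynomial.coeToMvPowerSeries.ringHom ∘ MvPolynomial.X =
      (X : σ → MvPowerSeries σ R) from funext MvPolynomial.coe_X] at h

theorem le_order_of_mem_span_X_pow {f : MvPowerSeries σ R} {p : ℕ}
    (hf : f ∈ Ideal.span (Set.range X) ^ p) : p ≤ f.order := by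
  have hX : Ideal.span (Set.range X) ≤ RingHom.ker (constantCoeff (σ := σ) (R := R)) :=
    Ideal.span_le.2 <| Set.range_subset_iff.2 constantCoeff_X
  induction p generalizing f with
  | zero => simp
  | succ p ih =>
    rw [pow_succ] at hf
    refine Submodule.mul_induction_on hf (fun g hg h hh => ?_)
      fun _ _ hg hh => (le_min hg hh).trans min_order_le_add
    push_cast
    exact (add_le_add (ih hg) (one_le_order_iff_constCoeff_eq_zero.2 (hX hh))).trans le_order_mul

theorem mem_span_X_pow_iff [Finite σ] {f : MvPowerSeries σ R} {p : ℕ} :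
    f ∈ Ideal.span (Set.range X) ^ p ↔ p ≤ f.order := by
  refine ⟨le_order_of_mem_span_X_pow, fun hf => ?_⟩
  obtain ⟨g, hg⟩ := IsPrecomplete.prec (I := .span (Set.range (X : σ → MvPowerSeries σ R)))
    inferInstance (f := fun N => (f.truncTotal N : MvPowerSeries σ R)) fun {M N} hMN => by
      rw [smul_eq_mul, Ideal.mul_top, SModEq.sub_mem,
        ← MvPolynomial.coeToMvPowerSeries.ringHom_apply,
        ← MvPolynomial.coeToMvPowerSeries.ringHom_apply, ← map_sub]
      exact coe_mem_span_X_pow (truncTotal_sub_truncTotal_mem_pow_idealOfVars le_rfl hMN f)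
  simp only [smul_eq_mul, Ideal.mul_top, SModEq.sub_mem] at hg
  have hgf : g = f := by
    ext a
    have ha : a.degree < a.degree + 1 := Nat.lt_succ_self _
    have hcoeff := coeff_of_lt_order (lt_of_lt_of_le (by exact_mod_cast ha)
      (le_order_of_mem_span_X_pow (hg (a.degree + 1))))
    rw [map_sub, sub_eq_zero, MvPolynomial.coeff_coe, coeff_truncTotal _ ha] at hcoeff
    exact hcoeff.symm
  have htrunc : f.truncTotal p = 0 := by
    ext a
    rw [coeff_truncTotal_eq_ite, MvPolynomial.coeff_zero]
    exact ite_eq_right_iff.2 fun ha => coeff_of_lt_order <|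
      lt_of_lt_of_le (by exact_mod_cast ha) hf
  simpa [htrunc, hgf] using hg p

end CommRing

end PowerSeries

theorem mem_maxIdeal_iff {σ : S k n} : σ ∈ maxIdeal k n ↔ constantCoeff σ = 0 := by
  rw [IsLocalRing.mem_maximalIdeal, mem_nonunits_iff, isUnit_iff_constantCoeff,
    isUnit_iff_ne_zero, not_not]

theorem X_mem_maxIdeal (i : Fin n) : (X i : S k n) ∈ maxIdeal k n :=
  mem_maxIdeal_iff.2 (constantCoeff_X i)

theorem sub_algebraMap_constantCoeff_mem_maxIdeal (σ : S k n) :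
    σ - algebraMap k (S k n) (constantCoeff σ) ∈ maxIdeal k n := by
  rw [mem_maxIdeal_iff]
  simp [MvPowerSeries.algebraMap_apply]

theorem maxIdeal_eq_span_X : maxIdeal k n = Ideal.span (Set.range X) := by
  ext σ
  rw [← pow_one (Ideal.span _), mem_span_X_pow_iff, Nat.cast_one,
    one_le_order_iff_constCoeff_eq_zero, mem_maxIdeal_iff]

instance : IsAdicComplete (maxIdeal k n) (S k n) := by
  rw [maxIdeal_eq_span_X]
  infer_instance

theorem mem_maxIdeal_pow_iff {e : ℕ} {σ : S k n} : σ ∈ maxIdeal k n ^ e ↔ e ≤ σ.order := by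
  rw [maxIdeal_eq_span_X, mem_span_X_pow_iff]

theorem mem_maxIdeal_pow_succ_iff {e : ℕ} {σ : S k n} :
    σ ∈ maxIdeal k n ^ (e + 1) ↔ σ ∈ maxIdeal k n ^ e ∧ homogeneousComponent e σ = 0 := by
  rw [mem_maxIdeal_pow_iff, mem_maxIdeal_pow_iff, nat_succ_le_order_iff]

theorem homogeneousComponent_eq_zero_of_mem {e D : ℕ} {σ : S k n} (hσ : σ ∈ maxIdeal k n ^ D)
    (he : e < D) : homogeneousComponent e σ = 0 :=
  homogeneousComponent_of_lt_order_eq_zero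
    (lt_of_lt_of_le (by exact_mod_cast he) (mem_maxIdeal_pow_iff.1 hσ))

theorem mem_maxIdeal_pow_of_isHomogeneous {e : ℕ} {σ : S k n} (hσ : IsHomogeneous σ e) :
    σ ∈ maxIdeal k n ^ e :=
  mem_maxIdeal_pow_iff.2 <| nat_le_order fun _ ha => hσ.coeff_eq_zero ha.ne

theorem homogeneousComponent_mem (e : ℕ) (σ : S k n) :
    homogeneousComponent e σ ∈ maxIdeal k n ^ e :=
  mem_maxIdeal_pow_of_isHomogeneous (isHomogeneous_homogeneousComponent σ e)

theorem sub_homogeneousComponent_mem {e : ℕ} {σ : S k n} (hσ : σ ∈ maxIdeal k n ^ e) :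
    σ - homogeneousComponent e σ ∈ maxIdeal k n ^ (e + 1) := by
  refine mem_maxIdeal_pow_succ_iff.2 ⟨Ideal.sub_mem _ hσ (homogeneousComponent_mem e σ), ?_⟩
  rw [map_sub, homogeneousComponent_homogeneousComponent, if_pos rfl, sub_self]

theorem sub_sum_homogeneousComponent_mem (σ : S k n) (N : ℕ) :
    σ - ∑ e ∈ Finset.range N, homogeneousComponent e σ ∈ maxIdeal k n ^ N := by
  refine mem_maxIdeal_pow_iff.2 <| nat_le_order fun a ha => ?_
  simp [map_sum, coeff_homogeneousComponent, ha]

/-! ### Automorphisms to first order -/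

theorem map_mul_sub_mul_self {A E : Type*} [CommRing A] [FunLike E A A] [MulHomClass E A A]
    (φ : E) (a b : A) : φ (a * b) - a * b = φ a * (φ b - b) + (φ a - a) * b := by
  rw [map_mul]
  ring

section AlgHom

variable {φ : S k n →ₐ[k] S k n} {p : ℕ} (hφ : ∀ i, φ (X i) - X i ∈ maxIdeal k n ^ (p + 1))

include hφ

theorem algHom_sub_self_mem_succ {j : ℕ} (hj : j ≤ p) (h : ∀ τ, φ τ - τ ∈ maxIdeal k n ^ j)
    {σ : S k n} (hσ : σ ∈ maxIdeal k n) : φ σ - σ ∈ maxIdeal k n ^ (j + 1) := by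
  rw [maxIdeal_eq_span_X] at hσ
  induction hσ using Submodule.span_induction with
  | mem _ hx =>
    obtain ⟨i, rfl⟩ := hx
    exact Ideal.pow_le_pow_right (by omega) (hφ i)
  | zero => simp
  | add σ τ _ _ hσ hτ => simpa [add_sub_add_comm] using Ideal.add_mem _ hσ hτ
  | smul a σ hσ hφσ =>
    rw [smul_eq_mul, map_mul_sub_mul_self]
    refine Ideal.add_mem _ (Ideal.mul_mem_left _ _ hφσ) ?_
    rw [pow_succ]
    exact Ideal.mul_mem_mul (h a) (by rwa [maxIdeal_eq_span_X])

theorem algHom_sub_self_mem {M : ℕ} {σ : S k n} (hσ : σ ∈ maxIdeal k n ^ M) :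
    φ σ - σ ∈ maxIdeal k n ^ (M + p) := by
  have hpow (j : ℕ) (hj : j ≤ p) (τ : S k n) : φ τ - τ ∈ maxIdeal k n ^ j := by
    induction j generalizing τ with
    | zero => simp
    | succ j ih =>
      simpa using algHom_sub_self_mem_succ hφ (by omega) (ih (by omega))
        (sub_algebraMap_constantCoeff_mem_maxIdeal τ)
  induction M generalizing σ with
  | zero => simpa using hpow p le_rfl σ
  | succ M ih =>
    rw [pow_succ'] at hσ
    refine Submodule.mul_induction_on hσ (fun a ha b hb => ?_) fun a b ha hb => ?_
    · have ha' : φ a - a ∈ maxIdeal k n ^ (p + 1) :=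
        algHom_sub_self_mem_succ hφ le_rfl (hpow p le_rfl) ha
      have hφa : φ a ∈ maxIdeal k n :=
        (Submodule.sub_mem_iff_left _ ha).1 (Ideal.pow_le_self p.succ_ne_zero ha')
      rw [map_mul_sub_mul_self]
      refine Ideal.add_mem _ ?_ ?_
      · rw [show M + 1 + p = (M + p) + 1 by omega, pow_succ']
        exact Ideal.mul_mem_mul hφa (ih hb)
      · rw [show M + 1 + p = (p + 1) + M by omega, pow_add]
        exact Ideal.mul_mem_mul ha' hb
    · simpa [add_sub_add_comm] using Ideal.add_mem _ ha hb

end AlgHom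

section IsAdicComplete

variable {A : Type*} [CommRing A] {I : Ideal A}

theorem mem_pow_of_sub_mem {L : A →+ A} (hL : ∀ M, ∀ a ∈ I ^ M, L a - a ∈ I ^ (M + 1)) {M : ℕ}
    {a : A} (ha : a ∈ I ^ M) : L a ∈ I ^ M :=
  (Submodule.sub_mem_iff_left _ ha).1 (Ideal.pow_le_pow_right M.le_succ (hL M a ha))

theorem eq_zero_of_forall_mem_pow [IsHausdorff I A] {a : A} (ha : ∀ N, a ∈ I ^ N) : a = 0 :=
  IsHausdorff.haus ‹_› a fun N => by
    simpa only [smul_eq_mul, Ideal.mul_top, SModEq.zero] using ha N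

theorem bijective_of_sub_mem_pow_succ [IsAdicComplete I A] (L : A →+ A)
    (hL : ∀ M, ∀ a ∈ I ^ M, L a - a ∈ I ^ (M + 1)) : Function.Bijective L := by
  refine ⟨(injective_iff_map_eq_zero L).2 fun a ha =>
    eq_zero_of_forall_mem_pow (I := I) fun N => ?_, fun b => ?_⟩
  · induction N with
    | zero => simp
    | succ N ih => simpa [ha] using hL N a ih
  · let x (N : ℕ) : A := (fun a => a + (b - L a))^[N] 0
    have hx (N : ℕ) : x (N + 1) = x N + (b - L (x N)) := Function.iterate_succ_apply' ..
    have hres (N : ℕ) : b - L (x N) ∈ I ^ N := by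
      induction N with
      | zero => simp
      | succ N ih =>
        rw [hx, map_add, ← sub_sub, ← neg_sub, Ideal.neg_mem_iff]
        exact hL N _ ih
    obtain ⟨y, hy⟩ := IsPrecomplete.prec (I := I) inferInstance (f := x) fun {M N} hMN => by
      rw [smul_eq_mul, Ideal.mul_top]
      induction N, hMN using Nat.le_induction with
      | base => rfl
      | succ N hMN ih =>
        refine ih.trans ?_
        rw [SModEq.sub_mem, hx, sub_add_cancel_left, Ideal.neg_mem_iff]
        exact Ideal.pow_le_pow_right hMN (hres N)
    refine ⟨y, (sub_eq_zero.1 <| eq_zero_of_forall_mem_pow (I := I) fun N => ?_).symm⟩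
    have hyN := hy N
    rw [smul_eq_mul, Ideal.mul_top, SModEq.sub_mem] at hyN
    simpa using Ideal.add_mem _ (hres N) (mem_pow_of_sub_mem hL hyN)

end IsAdicComplete

/-- `G` is the identity plus a map raising degrees by at least `q`, and the part of `G` raising
degrees by exactly `q` is that of `L`: in symbols, `G = 1 + L_q + (terms of degree > q)`. For
`L ∈ 𝔤⁺` such a `G` plays the role of `exp L_q`, but exists in every characteristic. -/
structure LiftsDegreePart (q : ℕ) (G L : Module.End k (S k n)) : Prop where
  sub_self_mem {M : ℕ} {τ : S k n} (hτ : τ ∈ maxIdeal k n ^ M) : G τ - τ ∈ maxIdeal k n ^ (M + q)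
  homogeneousComponent_eq {M : ℕ} {τ : S k n} (hτ : IsHomogeneous τ M) :
    homogeneousComponent (M + q) (G τ - τ) = homogeneousComponent (M + q) (L τ)

namespace LiftsDegreePart

variable {q M : ℕ} {G G₁ G₂ L L₁ L₂ : Module.End k (S k n)} {τ : S k n}

theorem apply_mem (h : LiftsDegreePart q G L) (hτ : τ ∈ maxIdeal k n ^ M) :
    G τ ∈ maxIdeal k n ^ M :=
  (Submodule.sub_mem_iff_left _ hτ).1 <|
    Ideal.pow_le_pow_right (M.le_add_right q) (h.sub_self_mem hτ)

theorem homogeneousComponent_eq_of_mem (h : LiftsDegreePart q G L) (hτ : τ ∈ maxIdeal k n ^ M) :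
    homogeneousComponent (M + q) (G τ - τ) =
      homogeneousComponent (M + q) (L (homogeneousComponent M τ)) := by
  rw [← h.homogeneousComponent_eq (isHomogeneous_homogeneousComponent τ M), ← sub_eq_zero,
    ← map_sub, sub_sub_sub_comm, ← map_sub]
  exact homogeneousComponent_eq_zero_of_mem
    (h.sub_self_mem (sub_homogeneousComponent_mem hτ)) (by omega)

theorem mul (hq : q ≠ 0) (h₁ : LiftsDegreePart q G₁ L₁) (h₂ : LiftsDegreePart q G₂ L₂) :
    LiftsDegreePart q (G₁ * G₂) (L₁ + L₂) where
  sub_self_mem hτ := by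
    simpa using Ideal.add_mem _ (h₁.sub_self_mem (h₂.apply_mem hτ)) (h₂.sub_self_mem hτ)
  homogeneousComponent_eq {M τ} hτ := by
    have hmem := mem_maxIdeal_pow_of_isHomogeneous hτ
    have hG₂ : homogeneousComponent M (G₂ τ) = τ := by
      rw [← sub_add_cancel (G₂ τ) τ, map_add, homogeneousComponent_of_isHomogeneous hτ,
        homogeneousComponent_eq_zero_of_mem (h₂.sub_self_mem hmem) (by omega), zero_add]
    rw [Module.End.mul_apply, LinearMap.add_apply, map_add, ← h₂.homogeneousComponent_eq hτ,
      ← sub_add_sub_cancel _ (G₂ τ), map_add,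
      h₁.homogeneousComponent_eq_of_mem (h₂.apply_mem hmem), hG₂]

theorem bijective (hq : q ≠ 0) (h : LiftsDegreePart q G L) : Function.Bijective G :=
  bijective_of_sub_mem_pow_succ (I := maxIdeal k n) G.toAddMonoidHom fun _ _ hτ =>
    Ideal.pow_le_pow_right (by omega) (h.sub_self_mem hτ)

end LiftsDegreePart

theorem liftsDegreePart_mulLeft (q : ℕ) (s : S k n) :
    LiftsDegreePart q (LinearMap.mulLeft k (1 + homogeneousComponent q s))
      (LinearMap.mul k (S k n) s) := by
  have hmul (τ : S k n) : LinearMap.mulLeft k (1 + homogeneousComponent q s) τ - τ =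
      τ * homogeneousComponent q s := by
    rw [LinearMap.mulLeft_apply]
    ring
  refine ⟨fun hτ => ?_, fun hτ => ?_⟩
  · rw [hmul, pow_add]
    exact Ideal.mul_mem_mul hτ (homogeneousComponent_mem q s)
  · rw [hmul, LinearMap.mul_apply', mul_comm s, homogeneousComponent_mul_of_isHomogeneous hτ,
      homogeneousComponent_mul_of_isHomogeneous hτ, homogeneousComponent_homogeneousComponent,
      if_pos rfl]

section Derivation

variable {φ : S k n →ₐ[k] S k n} {q : ℕ} {D : Derivation k (S k n) (S k n)}

theorem homogeneousComponent_algHom_mul (hq : q ≠ 0)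
    (hφ : ∀ i, φ (X i) - X i ∈ maxIdeal k n ^ (q + 1)) {M N : ℕ} {a b : S k n}
    (ha : IsHomogeneous a M) (hb : IsHomogeneous b N)
    (hDa : homogeneousComponent (M + q) (φ a - a) = homogeneousComponent (M + q) (D a))
    (hDb : homogeneousComponent (N + q) (φ b - b) = homogeneousComponent (N + q) (D b)) :
    homogeneousComponent (M + N + q) (φ (a * b) - a * b) =
      homogeneousComponent (M + N + q) (D (a * b)) := by
  have hsplit : φ (a * b) - a * b =
      a * (φ b - b) + b * (φ a - a) + (φ a - a) * (φ b - b) := by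
    rw [map_mul]
    ring
  have hcross : homogeneousComponent (M + N + q) ((φ a - a) * (φ b - b)) = 0 := by
    refine homogeneousComponent_eq_zero_of_mem (D := (M + q) + (N + q)) ?_ (by omega)
    rw [pow_add]
    exact Ideal.mul_mem_mul (algHom_sub_self_mem hφ (mem_maxIdeal_pow_of_isHomogeneous ha))
      (algHom_sub_self_mem hφ (mem_maxIdeal_pow_of_isHomogeneous hb))
  have hleft (x : S k n) :
      homogeneousComponent (M + N + q) (a * x) = a * homogeneousComponent (N + q) x := by
    rw [add_assoc, homogeneousComponent_mul_of_isHomogeneous ha]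
  have hright (x : S k n) :
      homogeneousComponent (M + N + q) (b * x) = b * homogeneousComponent (M + q) x := by
    rw [add_right_comm, add_comm, homogeneousComponent_mul_of_isHomogeneous hb]
  rw [hsplit, D.leibniz, smul_eq_mul, smul_eq_mul, map_add, map_add, map_add, hcross, add_zero,
    hleft, hright, hleft, hright, hDa, hDb]

theorem liftsDegreePart_algHom (hq : q ≠ 0)
    (hφ : ∀ i, φ (X i) = X i + homogeneousComponent (q + 1) (D (X i))) :
    LiftsDegreePart q φ.toLinearMap D := by
  have hX (i : Fin n) : φ (X i) - X i = homogeneousComponent (q + 1) (D (X i)) := by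
    rw [hφ, add_sub_cancel_left]
  have hmem (i : Fin n) : φ (X i) - X i ∈ maxIdeal k n ^ (q + 1) := by
    rw [hX]
    exact homogeneousComponent_mem _ _
  have hmonomial (a : Fin n →₀ ℕ) :
      homogeneousComponent (a.degree + q) (φ (monomial a 1) - monomial a 1) =
        homogeneousComponent (a.degree + q) (D (monomial a 1)) := by
    have hadd (a b : Fin n →₀ ℕ) (ha) (hb) := homogeneousComponent_algHom_mul (D := D) hq hmem
      (isHomogeneous_monomial a (1 : k)) (isHomogeneous_monomial b 1) ha hb
    simp only [monomial_mul_monomial, one_mul, ← map_add] at hadd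
    induction a using Finsupp.induction_linear with
    | zero => simp [monomial_zero_one]
    | add a b ha hb => exact hadd a b ha hb
    | single i m =>
      induction m with
      | zero => simp [monomial_zero_one]
      | succ m ih =>
        rw [Finsupp.single_add]
        refine hadd _ _ ih ?_
        rw [← X_def, hX, Finsupp.degree_single, add_comm 1 q,
          homogeneousComponent_homogeneousComponent, if_pos rfl]
  refine ⟨algHom_sub_self_mem hmem, fun {M τ} hτ => ?_⟩
  have hsum := homogeneousComponent_eq_sum M τ
  rw [homogeneousComponent_of_isHomogeneous hτ] at hsum
  rw [hsum, map_sum, map_sum, ← Finset.sum_sub_distrib, map_sum, map_sum]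
  refine Finset.sum_congr rfl fun a ha => ?_
  obtain rfl : a.degree = M := by
    rw [Finsupp.degree_eq_sum, (Finset.mem_finsuppAntidiag.1 ha).1]
  simp only [map_smul, ← smul_sub]
  exact congrArg _ (hmonomial a)

end Derivation

theorem exists_mem_unipotentGroup_liftsDegreePart {q : ℕ} (hq : q ≠ 0) {L : Module.End k (S k n)}
    (hL : L ∈ unipotentTangent k n) :
    ∃ G ∈ unipotentGroup k n, LiftsDegreePart q G L := by
  obtain ⟨_, ⟨D, -, rfl⟩, _, ⟨s, -, rfl⟩, rfl⟩ := Submodule.mem_sup.1 hL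
  have hsub : HasSubst fun i => X i + homogeneousComponent (q + 1) (D (X i)) :=
    hasSubst_of_constantCoeff_zero fun i => mem_maxIdeal_iff.1 <|
      Ideal.add_mem _ (X_mem_maxIdeal i) <| Ideal.pow_le_self q.succ_ne_zero <|
        homogeneousComponent_mem _ _
  have hφX := substAlgHom_X (R := k) hsub
  have hφ := liftsDegreePart_algHom hq hφX
  have hu := liftsDegreePart_mulLeft q s
  let φ : S k n ≃ₐ[k] S k n := AlgEquiv.ofBijective (substAlgHom hsub) (hφ.bijective hq)
  let u : S k n ≃ₗ[k] S k n := LinearEquiv.ofBijective _ (hu.bijective hq)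
  refine ⟨φ.toLinearEquiv * u, mul_mem (Subgroup.subset_closure <| Or.inl ⟨φ, fun i => ?_, rfl⟩)
    (Subgroup.subset_closure <| Or.inr ⟨_, ?_, fun τ => rfl⟩), hφ.mul hq hu⟩
  · exact Ideal.pow_le_pow_right (by omega)
      (hφ.sub_self_mem (mem_maxIdeal_pow_of_isHomogeneous (isHomogeneous_X i)))
  · rw [add_sub_cancel_left]
    exact Ideal.pow_le_self hq <| homogeneousComponent_mem _ _

/-! ### Functionals and forms -/

theorem apply_homogeneousComponent (f : P k n) (e : ℕ) (σ : S k n) :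
    f.1 (homogeneousComponent e σ) = (homogPart e f).1 σ := by
  rw [homogeneousComponent_eq_sum, map_sum, homogPart, Submodule.coe_sum, LinearMap.sum_apply]
  refine Finset.sum_congr rfl fun a _ => ?_
  rw [map_smul, smul_eq_mul, mul_comm]
  rfl

theorem degree_lt_iff_dpCoeff_eq_zero {f : P k n} {t : ℕ} :
    degree f < t ↔ ∀ a : Fin n →₀ ℕ, t ≤ a.degree → dpCoeff f a = 0 := by
  refine (Finset.sup_lt_iff (WithBot.bot_lt_coe t)).trans <| forall_congr' fun a => ?_
  rw [Set.Finite.mem_toFinset, Set.mem_ofPred_eq, not_imp_comm, not_lt]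
  exact imp_congr_left WithBot.coe_le_coe

theorem degree_lt_iff {f : P k n} {t : ℕ} :
    degree f < t ↔ ∀ σ ∈ maxIdeal k n ^ t, f.1 σ = 0 := by
  rw [degree_lt_iff_dpCoeff_eq_zero]
  refine ⟨fun hcoeff σ hσ => ?_,
    fun h a ha => h _ (Ideal.pow_le_pow_right ha (monomial_mem_pow a))⟩
  obtain ⟨N, hN⟩ := f.2
  have htrunc := hN _ (sub_sum_homogeneousComponent_mem σ N)
  rw [map_sub, sub_eq_zero] at htrunc
  rw [htrunc, map_sum]
  refine Finset.sum_eq_zero fun e _ => ?_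
  rcases lt_or_ge e t with he | he
  · rw [homogeneousComponent_eq_zero_of_mem hσ he, map_zero]
  · have hpart : homogPart e f = 0 := Finset.sum_eq_zero fun a ha => by
      rw [hcoeff a (by rwa [Finsupp.degree_eq_sum, (Finset.mem_finsuppAntidiag.1 ha).1]),
        zero_smul]
    rw [apply_homogeneousComponent, hpart]
    rfl

theorem apply_eq_of_degree_sub_lt {f g : P k n} {t : ℕ} (h : degree (f - g) < t) {σ : S k n}
    (hσ : σ ∈ maxIdeal k n ^ t) : f.1 σ = g.1 σ :=
  sub_eq_zero.1 (degree_lt_iff.1 h σ hσ)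

theorem degree_sub_homogPart_lt {f : P k n} {d : ℕ} (hd : degree f ≤ d) :
    degree (f - homogPart d f) < d := by
  refine degree_lt_iff.2 fun σ hσ => ?_
  change f.1 σ - (homogPart d f).1 σ = 0
  rw [← apply_homogeneousComponent, ← map_sub]
  exact degree_lt_iff.1 (hd.trans_lt (WithBot.coe_lt_coe.2 d.lt_succ_self)) _
    (sub_homogeneousComponent_mem hσ)

theorem mem_apolarIdeal_iff {f : P k n} {σ : S k n} :
    σ ∈ apolarIdeal f ↔ ∀ τ, f.1 (τ * σ) = 0 := by
  change contract σ f = 0 ↔ _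
  rw [Subtype.ext_iff, LinearMap.ext_iff]
  rfl

theorem exists_pow_le_apolarIdeal (f : P k n) : ∃ N, maxIdeal k n ^ N ≤ apolarIdeal f :=
  f.2.imp fun _ hN _ hσ => mem_apolarIdeal_iff.2 fun τ => hN _ (Ideal.mul_mem_left _ τ hσ)

/-- `F ∈ P` is homogeneous of degree `d`: its value on a power series depends only on the
homogeneous component of degree `d` of that series. -/
def IsForm (d : ℕ) (F : P k n) : Prop := ∀ σ, F.1 σ = F.1 (homogeneousComponent d σ)

theorem isForm_homogPart (d : ℕ) (f : P k n) : IsForm d (homogPart d f) := fun σ => by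
  rw [← apply_homogeneousComponent, ← apply_homogeneousComponent,
    homogeneousComponent_homogeneousComponent, if_pos rfl]

namespace IsForm

variable {d a b : ℕ} {F : P k n} {σ : S k n}

theorem apply_eq_zero_of_mem (hF : IsForm d F) (hσ : σ ∈ maxIdeal k n ^ a) (ha : d < a) :
    F.1 σ = 0 := by
  rw [hF, homogeneousComponent_eq_zero_of_mem hσ ha, map_zero]

theorem apply_homogeneousComponent_of_ne (hF : IsForm d F) (ha : d ≠ a) :
    F.1 (homogeneousComponent a σ) = 0 := by
  rw [hF, homogeneousComponent_homogeneousComponent, if_neg ha, map_zero]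

theorem apply_mul_homogeneousComponent (hF : IsForm d F) (hab : a + b = d) (σ τ : S k n) :
    F.1 (τ * homogeneousComponent a σ) = F.1 (homogeneousComponent b τ * σ) := by
  have hσ := homogeneousComponent_mul_of_isHomogeneous
    (isHomogeneous_homogeneousComponent σ a : IsHomogeneous _ a) b τ
  have hτ := homogeneousComponent_mul_of_isHomogeneous
    (isHomogeneous_homogeneousComponent τ b : IsHomogeneous _ b) a σ
  rw [hab] at hσ
  rw [add_comm, hab] at hτ
  rw [hF, mul_comm, hσ, mul_comm, ← hτ, ← hF]

theorem homogeneousComponent_mem_apolarIdeal_iff (hF : IsForm d F) :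
    homogeneousComponent a σ ∈ apolarIdeal F ↔
      ∀ b, a + b = d → ∀ τ, F.1 (homogeneousComponent b τ * σ) = 0 := by
  rw [mem_apolarIdeal_iff]
  refine ⟨fun h b hab τ => hF.apply_mul_homogeneousComponent hab σ τ ▸ h τ, fun h τ => ?_⟩
  rcases le_or_gt a d with had | had
  · rw [hF.apply_mul_homogeneousComponent (Nat.add_sub_cancel' had)]
    exact h _ (Nat.add_sub_cancel' had) τ
  · exact hF.apply_eq_zero_of_mem (Ideal.mul_mem_left _ _ (homogeneousComponent_mem a σ)) had

theorem homogeneousComponent_mem_apolarIdeal (hF : IsForm d F) (hσ : σ ∈ apolarIdeal F) (a : ℕ) :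
    homogeneousComponent a σ ∈ apolarIdeal F :=
  hF.homogeneousComponent_mem_apolarIdeal_iff.2 fun _ _ _ => mem_apolarIdeal_iff.1 hσ _

theorem initialForm_mem_apolarIdeal (hF : IsForm d F) {f : P k n} (hf : degree (f - F) < d)
    (hσ : σ ∈ apolarIdeal f) (ha : σ ∈ maxIdeal k n ^ a) :
    homogeneousComponent a σ ∈ apolarIdeal F := by
  refine hF.homogeneousComponent_mem_apolarIdeal_iff.2 fun b hab τ => ?_
  have hmem : homogeneousComponent b τ * σ ∈ maxIdeal k n ^ d := by
    rw [← hab, add_comm, pow_add]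
    exact Ideal.mul_mem_mul (homogeneousComponent_mem b τ) ha
  rw [← apply_eq_of_degree_sub_lt hf hmem, mem_apolarIdeal_iff.1 hσ]

end IsForm

/-! ### Lifting initial forms -/

section VectorSpace

variable {V : Type*} [AddCommGroup V] [Module k V]

theorem exists_isCompl_span_image {ι : Type*} {v : ι → V} {K : Submodule k V}
    (hv : Submodule.span k (Set.range v) ⊔ K = ⊤) :
    ∃ B : Set ι, IsCompl (Submodule.span k (v '' B)) K := by
  obtain ⟨κ, a, -, hspan, hind⟩ := exists_linearIndependent' k (K.mkQ ∘ v)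
  refine ⟨Set.range a, ?_⟩
  rw [← Set.range_comp]
  rw [Function.comp_assoc, Set.range_comp K.mkQ, Set.range_comp K.mkQ, ← Submodule.map_span,
    ← Submodule.map_span] at hspan
  refine ⟨?_, codisjoint_iff.2 ?_⟩
  · rw [← K.ker_mkQ]
    exact Submodule.range_ker_disjoint hind
  · rw [sup_comm, ← Submodule.comap_map_mkQ, hspan, Submodule.comap_map_mkQ, sup_comm, hv]

theorem isCompl_of_finrank_quotient_eq {C J K : Submodule k V} [FiniteDimensional k (V ⧸ J)]
    (hCK : IsCompl C K) (hCJ : Disjoint C J)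
    (hdim : Module.finrank k (V ⧸ J) = Module.finrank k (V ⧸ K)) : IsCompl C J := by
  have hinj : Function.Injective (J.mkQ.domRestrict C) := by
    rw [← LinearMap.ker_eq_bot, LinearMap.ker_domRestrict, Submodule.ker_mkQ]
    exact Submodule.disjoint_iff_comap_eq_bot.1 hCJ
  have hrange : LinearMap.range (J.mkQ.domRestrict C) = ⊤ := by
    refine Submodule.eq_top_of_finrank_eq ?_
    rw [LinearMap.finrank_range_of_inj hinj, hdim]
    exact (Submodule.quotientEquivOfIsCompl K C hCK.symm).finrank_eq.symm
  refine ⟨hCJ, codisjoint_iff.2 ?_⟩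
  rw [LinearMap.range_domRestrict] at hrange
  rw [sup_comm, ← Submodule.comap_map_mkQ, hrange, Submodule.comap_top]

end VectorSpace

theorem span_monomial_sup_pow (N : ℕ) :
    Submodule.span k ((fun a => (monomial a 1 : S k n)) '' {a | a.degree < N}) ⊔
      (maxIdeal k n ^ N).restrictScalars k = ⊤ := by
  refine eq_top_iff.2 fun σ _ => ?_
  rw [← add_sub_cancel (∑ e ∈ Finset.range N, homogeneousComponent e σ) σ]
  refine Submodule.add_mem_sup (Submodule.sum_mem _ fun e he => ?_)
    (sub_sum_homogeneousComponent_mem σ N)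
  rw [homogeneousComponent_eq_sum]
  refine Submodule.sum_mem _ fun a ha => Submodule.smul_mem _ _ <|
    Submodule.subset_span ⟨a, ?_, rfl⟩
  change a.degree < N
  rw [Finsupp.degree_eq_sum, (Finset.mem_finsuppAntidiag.1 ha).1]
  exact Finset.mem_range.1 he

theorem finiteDimensional_quotient_of_pow_le {N : ℕ} {J : Submodule k (S k n)}
    (hN : (maxIdeal k n ^ N).restrictScalars k ≤ J) : FiniteDimensional k (S k n ⧸ J) := by
  have hfin : ((fun a => (monomial a 1 : S k n)) '' {a | a.degree < N}).Finite :=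
    ((Finsupp.finite_of_degree_le N).subset <| Set.ofPred_subset_ofPred.2 fun _ => le_of_lt).image _
  refine ⟨Submodule.fg_def.2 ⟨_, hfin.image J.mkQ, ?_⟩⟩
  rw [← Submodule.map_span, ← Submodule.range_mkQ J, ← Submodule.map_top,
    ← span_monomial_sup_pow N, Submodule.map_sup,
    LinearMap.le_ker_iff_map.1 (hN.trans_eq J.ker_mkQ.symm), sup_bot_eq]

theorem homogeneousComponent_mem_span_monomial {B : Set (Fin n →₀ ℕ)} {w : S k n}
    (hw : w ∈ Submodule.span k ((fun a => (monomial a 1 : S k n)) '' B)) (e : ℕ) :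
    homogeneousComponent e w ∈ Submodule.span k ((fun a => (monomial a 1 : S k n)) '' B) := by
  rw [← Submodule.mem_comap]
  refine Submodule.span_le.2 ?_ hw
  rintro _ ⟨a, ha, rfl⟩
  rw [SetLike.mem_coe, Submodule.mem_comap,
    homogeneousComponent_eq_ite_of_isHomogeneous (isHomogeneous_monomial a 1)]
  split_ifs
  · exact Submodule.subset_span ⟨a, ha, rfl⟩
  · exact Submodule.zero_mem _

section InitialForms

variable {J K : Submodule k (S k n)}
  (hJK : ∀ σ ∈ J, ∀ c, σ ∈ maxIdeal k n ^ c → homogeneousComponent c σ ∈ K)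

include hJK

theorem mem_pow_succ_of_initialForm_mem {C : Submodule k (S k n)} (hCK : Disjoint C K)
    (hC : ∀ w ∈ C, ∀ c, homogeneousComponent c w ∈ C) {a : ℕ} {u w : S k n} (hu : u ∈ K)
    (hua : IsHomogeneous u a) (hw : w ∈ C) (huw : u - w ∈ J) : w ∈ maxIdeal k n ^ (a + 1) := by
  suffices ∀ c ≤ a + 1, w ∈ maxIdeal k n ^ c from this _ le_rfl
  intro c hc
  induction c with
  | zero => simp
  | succ c ih =>
    have hwc := ih (by omega)
    have huc : u ∈ maxIdeal k n ^ c :=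
      Ideal.pow_le_pow_right (by omega) (mem_maxIdeal_pow_of_isHomogeneous hua)
    have hcomp : homogeneousComponent c u ∈ K := by
      rw [homogeneousComponent_eq_ite_of_isHomogeneous hua]
      split_ifs
      exacts [hu, K.zero_mem]
    have hdiff := hJK _ huw c (Ideal.sub_mem _ huc hwc)
    rw [map_sub, Submodule.sub_mem_iff_right _ hcomp] at hdiff
    exact mem_maxIdeal_pow_succ_iff.2
      ⟨hwc, Submodule.disjoint_def.1 hCK _ (hC w hw c) hdiff⟩

theorem exists_sub_mem_pow_succ_of_finrank_eq [FiniteDimensional k (S k n ⧸ J)] {N : ℕ}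
    (hN : (maxIdeal k n ^ N).restrictScalars k ≤ K)
    (hdim : Module.finrank k (S k n ⧸ J) = Module.finrank k (S k n ⧸ K))
    {a : ℕ} {u : S k n} (hu : u ∈ K) (hua : IsHomogeneous u a) :
    ∃ v ∈ J, v - u ∈ maxIdeal k n ^ (a + 1) := by
  -- A complement of `K` spanned by monomials meets `J` trivially, as initial forms of `J` lie in
  -- `K`, so by dimension it is also a complement of `J`.
  obtain ⟨B, hB⟩ : ∃ B : Set (Fin n →₀ ℕ),
      IsCompl (Submodule.span k ((fun b => (monomial b 1 : S k n)) '' B)) K := by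
    refine exists_isCompl_span_image <| eq_top_iff.2 <| (span_monomial_sup_pow N).ge.trans ?_
    exact sup_le_sup (Submodule.span_mono (Set.image_subset_range _ _)) hN
  set C := Submodule.span k ((fun b => (monomial b 1 : S k n)) '' B)
  have hmem {a : ℕ} {u w : S k n} := mem_pow_succ_of_initialForm_mem hJK hB.disjoint
    (fun w hw => homogeneousComponent_mem_span_monomial hw) (a := a) (u := u) (w := w)
  have hCJ : Disjoint C J := by
    refine Submodule.disjoint_def.2 fun w hw hwJ =>
      eq_zero_of_forall_mem_pow (I := maxIdeal k n) fun a => ?_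
    refine Ideal.pow_le_pow_right a.le_succ (hmem K.zero_mem (isHomogeneous_zero a) hw ?_)
    rwa [zero_sub, J.neg_mem_iff]
  obtain ⟨w, hw, v, hv, hsum⟩ :=
    Submodule.mem_sup.1 ((isCompl_of_finrank_quotient_eq hB hCJ hdim).sup_eq_top ▸
      Submodule.mem_top (x := u))
  obtain rfl : v = u - w := eq_sub_of_add_eq' hsum
  refine ⟨_, hv, ?_⟩
  rw [sub_sub_cancel_left, Ideal.neg_mem_iff]
  exact hmem hu hua hw hv

end InitialForms

/-! ### The degree-`e` part of `f` and the tangent space -/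

theorem finrank_quotient_restrictScalars (I : Ideal (S k n)) :
    Module.finrank k (S k n ⧸ I.restrictScalars k) = Module.finrank k (S k n ⧸ I) :=
  (Submodule.Quotient.restrictScalarsEquiv k I).finrank_eq

namespace IsForm

variable {d : ℕ} {f F : P k n} (hF : IsForm d F)
  (hdim : Module.finrank k (Apolar f) = Module.finrank k (Apolar F))

include hF hdim

theorem exists_mem_apolarIdeal_sub_mem (hf : degree (f - F) < d) {a : ℕ} {u : S k n}
    (hu : u ∈ apolarIdeal F) (hua : IsHomogeneous u a) :
    ∃ v ∈ apolarIdeal f, v - u ∈ maxIdeal k n ^ (a + 1) := by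
  obtain ⟨N, hN⟩ := exists_pow_le_apolarIdeal f
  obtain ⟨M, hM⟩ := exists_pow_le_apolarIdeal F
  have : FiniteDimensional k (S k n ⧸ (apolarIdeal f).restrictScalars k) :=
    finiteDimensional_quotient_of_pow_le (Submodule.restrictScalars_mono k hN)
  refine exists_sub_mem_pow_succ_of_finrank_eq (J := (apolarIdeal f).restrictScalars k)
    (K := (apolarIdeal F).restrictScalars k)
    (fun σ hσ c hc => hF.initialForm_mem_apolarIdeal hf hσ hc)
    (Submodule.restrictScalars_mono k hM) ?_ hu hua
  rw [finrank_quotient_restrictScalars, finrank_quotient_restrictScalars, hdim]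

theorem apply_mul_eq_zero {a b : ℕ} (hf : degree (f - F) < (a + b + 1 : ℕ)) (hab : a + b < d)
    {x y : S k n} (hx : x ∈ apolarIdeal F) (hxa : IsHomogeneous x a) (hy : y ∈ apolarIdeal F)
    (hyb : IsHomogeneous y b) : f.1 (x * y) = 0 := by
  obtain ⟨v, hv, hvx⟩ := hF.exists_mem_apolarIdeal_sub_mem hdim
    (hf.trans_le (WithBot.coe_le_coe.2 hab)) hx hxa
  have hmem : (v - x) * y ∈ maxIdeal k n ^ (a + b + 1) := by
    rw [add_right_comm, pow_add]
    exact Ideal.mul_mem_mul hvx (mem_maxIdeal_pow_of_isHomogeneous hyb)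
  have hv_mul : f.1 (v * y) = 0 := by rw [mul_comm, mem_apolarIdeal_iff.1 hv]
  have hsub_mul : f.1 ((v - x) * y) = 0 := by
    rw [apply_eq_of_degree_sub_lt hf hmem, mem_apolarIdeal_iff.1 hy]
  rwa [sub_mul, map_sub, hv_mul, zero_sub, neg_eq_zero] at hsub_mul

theorem apply_homogeneousComponent_eq_zero_of_mem_sq {e : ℕ} (he : e < d)
    (hf : degree (f - F) < (e + 1 : ℕ)) {σ : S k n} (hσ : σ ∈ apolarIdeal F ^ 2) :
    f.1 (homogeneousComponent e σ) = 0 := by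
  rw [pow_two] at hσ
  refine Submodule.mul_induction_on hσ (fun x hx y hy => ?_) fun x y hx hy => ?_
  · rw [homogeneousComponent_mul, map_sum]
    refine Finset.sum_eq_zero fun ⟨a, b⟩ hab => ?_
    obtain rfl := Finset.HasAntidiagonal.mem_antidiagonal.1 hab
    exact hF.apply_mul_eq_zero hdim hf he (hF.homogeneousComponent_mem_apolarIdeal hx a)
      (isHomogeneous_homogeneousComponent x a) (hF.homogeneousComponent_mem_apolarIdeal hy b)
      (isHomogeneous_homogeneousComponent y b)
  · rw [map_add, map_add, hx, hy, add_zero]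

end IsForm

theorem finiteDimensional_range_homogeneousComponent (e : ℕ) :
    FiniteDimensional k (LinearMap.range (homogeneousComponent e : S k n →ₗ[k] S k n)) := by
  have : FiniteDimensional k (S k n ⧸
      LinearMap.ker (homogeneousComponent e : S k n →ₗ[k] S k n)) :=
    finiteDimensional_quotient_of_pow_le (N := e + 1) fun _ hσ =>
      homogeneousComponent_eq_zero_of_mem hσ e.lt_succ_self
  exact Module.Finite.equiv (LinearMap.quotKerEquivRange _)

theorem exists_mem_eq_on_isHomogeneous (W : Submodule k (Module.Dual k (S k n))) {e : ℕ}
    {f : Module.Dual k (S k n)} (hf : ∀ σ ∈ gradedPart e (perp W), f σ = 0) :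
    ∃ w ∈ W, ∀ τ, IsHomogeneous τ e → w τ = f τ := by
  let V := LinearMap.range (homogeneousComponent e : S k n →ₗ[k] S k n)
  have : FiniteDimensional k V := finiteDimensional_range_homogeneousComponent e
  have hmem : V.subtype.dualMap f ∈ W.map V.subtype.dualMap := by
    rw [← Subspace.dualCoannihilator_dualAnnihilator_eq (W := W.map _),
      Submodule.mem_dualAnnihilator]
    rintro ⟨_, σ, rfl⟩ hσ
    refine hf _ ⟨(Submodule.mem_dualCoannihilator _).2 fun w hw => ?_,
      isHomogeneous_homogeneousComponent σ e⟩
    exact (Submodule.mem_dualCoannihilator _).1 hσ _ (Submodule.mem_map_of_mem hw)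
  obtain ⟨w, hw, hwf⟩ := hmem
  exact ⟨w, hw, fun τ hτ =>
    LinearMap.congr_fun hwf ⟨τ, τ, homogeneousComponent_of_isHomogeneous hτ⟩⟩

/-! ### Orbits -/

theorem isUnit_of_sub_one_mem_maxIdeal {s : S k n} (hs : s - 1 ∈ maxIdeal k n) : IsUnit s := by
  have hconst := mem_maxIdeal_iff.1 hs
  rw [map_sub, map_one, sub_eq_zero] at hconst
  exact isUnit_iff_constantCoeff.2 (hconst ▸ isUnit_one)

theorem exists_isUnit_mul_algEquiv {L : S k n ≃ₗ[k] S k n} (hL : L ∈ unipotentGroup k n) :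
    ∃ (u : S k n) (φ : S k n ≃ₐ[k] S k n), IsUnit u ∧ ∀ τ, L τ = u * φ τ := by
  induction hL using Subgroup.closure_induction with
  | mem L hL =>
    rcases hL with ⟨φ, -, rfl⟩ | ⟨s, hs, hL⟩
    · exact ⟨1, φ, isUnit_one, fun τ => (one_mul _).symm⟩
    · exact ⟨s, AlgEquiv.refl, isUnit_of_sub_one_mem_maxIdeal hs, hL⟩
  | one => exact ⟨1, AlgEquiv.refl, isUnit_one, fun τ => (one_mul _).symm⟩
  | mul L₁ L₂ _ _ h₁ h₂ =>
    obtain ⟨u₁, φ₁, hu₁, h₁⟩ := h₁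
    obtain ⟨u₂, φ₂, hu₂, h₂⟩ := h₂
    refine ⟨u₁ * φ₁ u₂, φ₂.trans φ₁, hu₁.mul (hu₂.map φ₁), fun τ => ?_⟩
    rw [LinearEquiv.mul_apply, h₁, h₂, map_mul, mul_assoc]
    rfl
  | inv L _ h =>
    obtain ⟨u, φ, hu, h⟩ := h
    obtain ⟨v, huv⟩ := hu.exists_right_inv
    have hv : IsUnit v := .of_mul_eq_one u (by rw [mul_comm, huv])
    refine ⟨φ.symm v, φ.symm, hv.map φ.symm, fun τ => L.injective ?_⟩
    rw [← map_mul, h (φ.symm _), AlgEquiv.apply_symm_apply, ← mul_assoc, huv, one_mul]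
    exact L.apply_symm_apply τ

theorem nonempty_apolar_algEquiv {f h : P k n} (hh : h ∈ unipotentOrbit f) :
    Nonempty (Apolar f ≃ₐ[k] Apolar h) := by
  obtain ⟨L, hL, hLh⟩ := hh
  obtain ⟨u, φ, hu, hφ⟩ := exists_isUnit_mul_algEquiv hL
  have happly (τ σ : S k n) : h.1 (τ * σ) = f.1 (u * φ τ * φ σ) := by
    rw [hLh, mul_assoc, ← map_mul, ← hφ]
    rfl
  have hsurj : Function.Surjective fun τ => u * φ τ :=
    (IsUnit.isUnit_iff_mulLeft_bijective.1 hu).surjective.comp φ.surjective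
  have hcomap : apolarIdeal h = (apolarIdeal f).comap (φ : S k n →+* S k n) := by
    ext σ
    rw [Ideal.mem_comap, mem_apolarIdeal_iff, mem_apolarIdeal_iff]
    exact (forall_congr' fun τ => by rw [happly]; rfl).trans hsurj.forall.symm
  refine ⟨(Ideal.quotientEquivAlg (apolarIdeal h) (apolarIdeal f) φ ?_).symm⟩
  rw [hcomap]
  exact (Ideal.map_comap_of_surjective _ φ.surjective _).symm

theorem self_mem_unipotentOrbit (f : P k n) : f ∈ unipotentOrbit f :=
  ⟨1, one_mem _, rfl⟩

theorem mem_unipotentOrbit_trans {f g h : P k n} (hg : g ∈ unipotentOrbit f)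
    (hh : h ∈ unipotentOrbit g) : h ∈ unipotentOrbit f := by
  obtain ⟨L₁, h₁, hg⟩ := hg
  obtain ⟨L₂, h₂, hh⟩ := hh
  exact ⟨L₁ * L₂, mul_mem h₁ h₂, by rw [hh, hg]; rfl⟩

theorem LiftsDegreePart.comp_mem {q : ℕ} {G L : Module.End k (S k n)}
    (h : LiftsDegreePart q G L) (f : P k n) : f.1 ∘ₗ G ∈ P k n :=
  f.2.imp fun _ hN _ hσ => hN _ (h.apply_mem hσ)

namespace IsForm

variable {d : ℕ} {f F : P k n} (hF : IsForm d F)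

include hF

theorem apply_sub_self_of_liftsDegreePart {e q : ℕ} (hd : e + q = d) {G L : Module.End k (S k n)}
    (hG : LiftsDegreePart q G L) {σ : S k n} (hσ : σ ∈ maxIdeal k n ^ e) :
    F.1 (G σ - σ) = F.1 (L (homogeneousComponent e σ)) := by
  rw [hF, hF (L _), ← hd, hG.homogeneousComponent_eq_of_mem hσ]

theorem exists_mem_unipotentOrbit_of_tangent {e : ℕ} (he : e < d)
    (hf : degree (f - F) < (e + 1 : ℕ)) {L : Module.End k (S k n)} (hL : L ∈ unipotentTangent k n)
    (hLf : ∀ τ, IsHomogeneous τ e → F.1 (L τ) = f.1 τ) :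
    ∃ h ∈ unipotentOrbit f, degree (h - F) < e := by
  obtain ⟨G, hG, hGL⟩ := exists_mem_unipotentGroup_liftsDegreePart (Nat.sub_ne_zero_of_lt he)
    (Submodule.neg_mem _ hL)
  refine ⟨⟨_, hGL.comp_mem f⟩, ⟨G, hG, rfl⟩, degree_lt_iff.2 fun σ hσ => sub_eq_zero.2 ?_⟩
  have hinitial : f.1 (G σ - σ) = -f.1 (homogeneousComponent e σ) := calc
    f.1 (G σ - σ) = F.1 (G σ - σ) := apply_eq_of_degree_sub_lt hf <|
      Ideal.pow_le_pow_right (by omega) (hGL.sub_self_mem hσ)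
    _ = F.1 (-L (homogeneousComponent e σ)) :=
      hF.apply_sub_self_of_liftsDegreePart (Nat.add_sub_cancel' he.le) hGL hσ
    _ = -f.1 (homogeneousComponent e σ) := by
      rw [map_neg, hLf _ (isHomogeneous_homogeneousComponent σ e)]
  calc
    f.1 (G σ) = f.1 (σ - homogeneousComponent e σ) := by
      rw [← sub_add_cancel (G σ) σ, map_add, hinitial, map_sub, neg_add_eq_sub]
    _ = F.1 (σ - homogeneousComponent e σ) :=
      apply_eq_of_degree_sub_lt hf (sub_homogeneousComponent_mem hσ)
    _ = F.1 σ := by rw [map_sub, hF.apply_homogeneousComponent_of_ne he.ne', sub_zero]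

theorem exists_mem_unipotentOrbit_degree_sub_lt
    (hf : degree (f - F) < d) (hdim : Module.finrank k (Apolar f) = Module.finrank k (Apolar F))
    {t : ℕ} (htd : t ≤ d) (hsq : ∀ i, t ≤ i → i < d → gradedPart i (perp (tangentSpace F)) ⊆
      gradedPart i ((apolarIdeal F ^ 2).restrictScalars k)) :
    ∃ h ∈ unipotentOrbit f, degree (h - F) < t := by
  induction htd using Nat.decreasingInduction with
  | self => exact ⟨f, self_mem_unipotentOrbit f, hf⟩
  | of_succ e he ih =>
    obtain ⟨h, hh, hhF⟩ := ih fun i hi => hsq i (Nat.le_of_succ_le hi)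
    obtain ⟨ψ⟩ := nonempty_apolar_algEquiv hh
    have hdim' : Module.finrank k (Apolar h) = Module.finrank k (Apolar F) :=
      ψ.toLinearEquiv.finrank_eq.symm.trans hdim
    have hvanish : ∀ σ ∈ gradedPart e (perp (tangentSpace F)), h.1 σ = 0 := fun σ hσ => by
      rw [← homogeneousComponent_of_isHomogeneous hσ.2]
      exact hF.apply_homogeneousComponent_eq_zero_of_mem_sq hdim' he hhF (hsq e le_rfl he hσ).1
    obtain ⟨_, ⟨L, hL, rfl⟩, hLh⟩ := exists_mem_eq_on_isHomogeneous _ hvanish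
    obtain ⟨g, hg, hgF⟩ := hF.exists_mem_unipotentOrbit_of_tangent he hhF hL hLh
    exact ⟨g, mem_unipotentOrbit_trans hh hg, hgF⟩

end IsForm

end Macaulay

theorem mainTheorem12_general (k : Type*) [Field k] (n : ℕ)
    (f F : Macaulay.P k n) (d : ℕ) (hd : Macaulay.degree f = d)
    (hF : F = Macaulay.homogPart d f)
    (I : Ideal (Macaulay.S k n)) (hI : I = Macaulay.apolarIdeal F)
    (t : ℕ)
    (hdim : Module.finrank k (Macaulay.Apolar f) = Module.finrank k (Macaulay.Apolar F))
    (hsq : ∀ i : ℕ, t ≤ i → i < d →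
      Macaulay.gradedPart i (Macaulay.perp (Macaulay.tangentSpace F)) ⊆
        Macaulay.gradedPart i ((I ^ 2).restrictScalars k)) :
    ∃ g : Macaulay.P k n, Macaulay.degree g < t ∧
      F + g ∈ Macaulay.unipotentOrbit f ∧
      Nonempty (Macaulay.Apolar f ≃ₐ[k] Macaulay.Apolar (F + g)) := by
  subst hF hI
  have hform := Macaulay.isForm_homogPart d f
  have hf := Macaulay.degree_sub_homogPart_lt hd.le
  obtain ⟨h, hh, hht⟩ : ∃ h ∈ Macaulay.unipotentOrbit f,
      Macaulay.degree (h - Macaulay.homogPart d f) < t := by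
    rcases le_total t d with htd | hdt
    · exact hform.exists_mem_unipotentOrbit_degree_sub_lt hf hdim htd hsq
    · exact ⟨f, Macaulay.self_mem_unipotentOrbit f, hf.trans_le (WithBot.coe_le_coe.2 hdt)⟩
  refine ⟨h - Macaulay.homogPart d f, hht, ?_⟩
  rw [add_sub_cancel (Macaulay.homogPart d f) h]
  exact ⟨hh, Macaulay.nonempty_apolar_algEquiv hh⟩

theorem mainTheorem12 (k : Type*) [Field k] [IsAlgClosed k] (n : ℕ)
    (f F : Macaulay.P k n) (d : ℕ) (hd : Macaulay.degree f = d)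
    (hF : F = Macaulay.homogPart d f)
    (hchar : ringChar k = 0 ∨ d < ringChar k)
    (I : Ideal (Macaulay.S k n)) (hI : I = Macaulay.apolarIdeal F)
    (t : ℕ)
    (hdim : Module.finrank k (Macaulay.Apolar f) = Module.finrank k (Macaulay.Apolar F))
    (hsq : ∀ i : ℕ, t ≤ i → i < d →
      Macaulay.gradedPart i (Macaulay.perp (Macaulay.tangentSpace F)) =
        Macaulay.gradedPart i ((I ^ 2).restrictScalars k)) :
    ∃ g : Macaulay.P k n, Macaulay.degree g < t ∧
      F + g ∈ Macaulay.unipotentOrbit f ∧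
      Nonempty (Macaulay.Apolar f ≃ₐ[k] Macaulay.Apolar (F + g)) :=
  mainTheorem12_general k n f F d hd hF I hI t hdim fun i hti hid => (hsq i hti hid).subset
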